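/- A cover of a finite group $G$ is a group $G^*$ together with a surjective homomorphism $\pi\colon G^*\to G$ such that $\ker\pi\subseteq Z(G^*)$, $\ker\pi\subseteq[G^*,G^*]$, and $\ker\pi$ is isomorphic to the Schur multiplier $M(G)=H^2(G,\mathbb{C}^\times)$ (with trivial action of $G$ on $\mathbb{C}^\times$). **Corollary 4.8 (Read's theorem for Abelian groups).** Let $G$ be a finite Abelian group. Then the image in $G$ of the centre of a cover does not depend on the cover: if $\pi_1\colon G_1^*\to G$ and $\pi_2\colon G_2^*\to G$ are covers of $G$, then $$\pi_1(Z(G_1^*))=\pi_2(Z(G_2^*))$$ as subgroups of $G$. -/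

import Mathlib

universe u

/-- The Schur multiplier `M(G) = H²(G, ℂˣ)` of a group `G`: second cohomology of `G` with
coefficients in the multiplicative group of `ℂ` (written additively) with trivial action.
The `ULift`s only serve to put `ℤ` and `ℂˣ` in the universe of `G`. -/
noncomputable abbrev SchurMultiplier (G : Type u) [Group G] : Type u :=
  groupCohomology.H2 (Rep.trivial (ULift.{u} ℤ) G (ULift.{u} (Additive ℂˣ)))

/-- A homomorphism `π : E → G` onto a finite group `G` is a cover of `G` if
`1 → ker π → E → G → 1` is a central extension with `ker π ≤ [E, E]` and with `ker π`
isomorphic to the Schur multiplier of `G`. -/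
structure IsCover {E : Type*} {G : Type u} [Group E] [Group G] [Finite G] (π : E →* G) :
    Prop where
  surjective : Function.Surjective π
  ker_le_center : π.ker ≤ Subgroup.center E
  ker_le_commutator : π.ker ≤ commutator E
  ker_equiv : Nonempty (Additive π.ker ≃+ SchurMultiplier G)

/-! In a cover, commutators lie in the central kernel and depend only on images in `G`, so each
character of the kernel yields an alternating bihomomorphism `G × G → ℂˣ`. This assignment is
injective because commutators generate a group containing the kernel. Conversely, alternating
bihomomorphisms embed into the Schur multiplier, which has as many elements as the kernel has
characters; hence every one arises. So the image of the centre is their common radical, which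
involves only `G`. -/

/-- A finite commutative group has finitely many endomorphisms with cyclic image whose pointwise
product is the identity. -/
theorem CommGroup.exists_prod_cyclic_projections (G : Type*) [CommGroup G] [Finite G] :
    ∃ (ι : Type) (_ : Fintype ι) (p : ι → G →* G),
      (∀ x, ∏ i, p i x = x) ∧ ∀ i, ∃ z, ∀ x, p i x ∈ Subgroup.zpowers z := by
  classical
  obtain ⟨ι, hι, n, -, ⟨e⟩⟩ := CommGroup.equiv_prod_multiplicative_zmod_of_finite G
  let s (i : ι) : Multiplicative (ZMod (n i)) →* G :=
    e.symm.toMonoidHom.comp (MonoidHom.mulSingle (fun i => Multiplicative (ZMod (n i))) i)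
  refine ⟨ι, hι, fun i => ((s i).comp (Pi.evalMonoidHom _ i)).comp e.toMonoidHom, fun x => ?_,
    fun i => ?_⟩
  · apply e.injective
    rw [map_prod]
    simp only [s, MonoidHom.comp_apply, MulEquiv.toMonoidHom_eq_coe, MonoidHom.coe_coe,
      MulEquiv.apply_symm_apply]
    exact Finset.univ_prod_mulSingle (e x)
  · obtain ⟨z, hz⟩ := IsCyclic.exists_generator (α := Multiplicative (ZMod (n i)))
    refine ⟨s i z, fun x => ?_⟩
    obtain ⟨k, hk⟩ := hz (e x i)
    exact ⟨k, by simpa using congrArg (s i) hk⟩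

/-- An alternating bihomomorphism takes the value `1` on pairs from a cyclic subgroup. -/
theorem MonoidHom.alternating_eq_one_of_mem_zpowers {G M : Type*} [CommGroup G] [CommGroup M]
    (ω : G →* G →* M) (hω : ∀ g, ω g g = 1) {x y z : G} (hx : x ∈ Subgroup.zpowers z)
    (hy : y ∈ Subgroup.zpowers z) : ω x y = 1 := by
  obtain ⟨m, rfl⟩ := hx
  obtain ⟨n, rfl⟩ := hy
  simp [hω]

/-- An alternating bihomomorphism is antisymmetric. -/
theorem MonoidHom.alternating_swap {G M : Type*} [CommGroup G] [CommGroup M]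
    (ω : G →* G →* M) (hω : ∀ g, ω g g = 1) (x y : G) : ω y x = (ω x y)⁻¹ := by
  have h := hω (x * y)
  simp only [map_mul, MonoidHom.mul_apply, hω, one_mul, mul_one] at h
  exact eq_inv_of_mul_eq_one_left h

/-- Every alternating bihomomorphism on a finite commutative group is the antisymmetrization of a
bihomomorphism. -/
theorem MonoidHom.exists_div_swap_eq_of_alternating {G M : Type*} [CommGroup G] [Finite G]
    [CommGroup M] (ω : G →* G →* M) (hω : ∀ g, ω g g = 1) :
    ∃ β : G →* G →* M, ∀ g h, β g h / β h g = ω g h := by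
  classical
  obtain ⟨ι, _, p, hp, hc⟩ := CommGroup.exists_prod_cyclic_projections G
  let _ : LinearOrder ι := IsWellOrder.linearOrder WellOrderingRel
  -- Take the strictly upper triangular part of `ω` for a cyclic decomposition; the diagonal blocks
  -- of `ω` are trivial.
  refine ⟨∏ i, ∏ j, if i < j then (ω.comp (p i)).compl₂ (p j) else 1, fun g h => ?_⟩
  have hβ (x y : G) : (∏ i, ∏ j, if i < j then (ω.comp (p i)).compl₂ (p j) else 1) x y =
      ∏ i, ∏ j, if i < j then ω (p i x) (p j y) else 1 := by
    simp only [MonoidHom.finsetProd_apply]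
    refine Finset.prod_congr rfl fun i _ => Finset.prod_congr rfl fun j _ => ?_
    split_ifs <;> simp
  have hexp : ω g h = ∏ i, ∏ j, ω (p i g) (p j h) := by
    conv_lhs => rw [← hp g, ← hp h]
    simp only [map_prod, MonoidHom.finsetProd_apply]
    exact Finset.prod_comm
  rw [hβ, hβ, hexp, Finset.prod_comm (f := fun i j => if i < j then ω (p i h) (p j g) else 1)]
  simp only [← Finset.prod_div_distrib]
  refine Finset.prod_congr rfl fun i _ => Finset.prod_congr rfl fun j _ => ?_
  rcases lt_trichotomy i j with hij | rfl | hij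
  · simp [hij, hij.not_gt]
  · obtain ⟨z, hz⟩ := hc i
    simp [ω.alternating_eq_one_of_mem_zpowers hω (hz g) (hz h)]
  · simp [hij, hij.not_gt, ω.alternating_swap hω (p i g) (p j h)]

/-- The alternating bihomomorphisms on a commutative group. -/
abbrev AlternatingBihom (G M : Type*) [CommGroup G] [CommGroup M] : Type _ :=
  {ω : G →* G →* M // ∀ g, ω g g = 1}

/-- A bihomomorphism is a `2`-cocycle with trivial action. -/
theorem SchurMultiplier.bihom_mem_cocycles₂ {G : Type u} [CommGroup G] (β : G →* G →* ℂˣ) :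
    (fun x : G × G => ULift.up (Additive.ofMul (β x.1 x.2))) ∈ groupCohomology.cocycles₂
      (Rep.trivial (ULift.{u} ℤ) G (ULift.{u} (Additive ℂˣ))) := by
  rw [groupCohomology.mem_cocycles₂_iff]
  intro g h j
  apply ULift.down_injective
  apply Additive.toMul.injective
  simp [mul_comm, mul_left_comm]

/-- Alternating bihomomorphisms on a finite commutative group embed into its Schur multiplier. -/
theorem SchurMultiplier.exists_injective_alternatingBihom (G : Type u) [CommGroup G] [Finite G] :
    ∃ f : AlternatingBihom G ℂˣ → SchurMultiplier G, Function.Injective f := by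
  choose β hβ using fun ω : AlternatingBihom G ℂˣ =>
    MonoidHom.exists_div_swap_eq_of_alternating ω.1 ω.2
  refine ⟨fun ω => groupCohomology.H2π _ ⟨_, bihom_mem_cocycles₂ (β ω)⟩, fun ω ω' h => ?_⟩
  rw [groupCohomology.H2π_eq_iff] at h
  obtain ⟨f, hf⟩ := h
  -- Over a commutative group with trivial action, coboundaries are symmetric.
  have key (x y : G) : β ω x y / β ω' x y = β ω y x / β ω' y x := by
    have hsymm : (groupCohomology.d₁₂ _).hom f (x, y) = (groupCohomology.d₁₂ _).hom f (y, x) := by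
      simp only [groupCohomology.d₁₂_hom_apply, Representation.isTrivial_def, LinearMap.id_coe,
        id_eq, mul_comm x y]
      abel
    exact congrArg (fun t => t.down.toMul)
      ((congrFun hf (x, y)).symm.trans (hsymm.trans (congrFun hf (y, x))))
  ext x y : 3
  rw [← hβ ω, ← hβ ω', div_eq_div_iff_div_eq_div, key]

open scoped commutatorElement

section CommutatorPairing

variable {E G M : Type*} [Group E] [CommGroup G] [CommGroup M] {π : E →* G}

theorem commutatorElement_mem_ker (π : E →* G) (a b : E) : ⁅a, b⁆ ∈ π.ker := by
  rw [MonoidHom.mem_ker, map_commutatorElement, commutatorElement_eq_one_iff_mul_comm, mul_comm]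

/-- In `⁅a * b, c⁆` the factor `⁅b, c⁆` appears conjugated by `a`, but it is central. -/
theorem commutatorElement_mul_left_of_ker_le_center (hc : π.ker ≤ Subgroup.center E) (a b c : E) :
    ⁅a * b, c⁆ = ⁅a, c⁆ * ⁅b, c⁆ := by
  have h₁ := Subgroup.mem_center_iff.1 (hc (commutatorElement_mem_ker π b c))
  rw [commutatorElement_mul_left_eq_conj_mul, h₁ a,
    mul_inv_cancel_right, h₁]

theorem commutatorElement_mul_right_of_ker_le_center (hc : π.ker ≤ Subgroup.center E)
    (a b c : E) : ⁅a, b * c⁆ = ⁅a, b⁆ * ⁅a, c⁆ := by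
  rw [← commutatorElement_inv, commutatorElement_mul_left_of_ker_le_center hc, mul_inv_rev,
    commutatorElement_inv, commutatorElement_inv]
  exact (Subgroup.mem_center_iff.1 (hc (commutatorElement_mem_ker π a b)) _)

/-- Two lifts differ by a central factor, which commutators ignore. -/
theorem commutatorElement_congr_of_ker_le_center (hc : π.ker ≤ Subgroup.center E) {a a' b b' : E}
    (ha : π a = π a') (hb : π b = π b') : ⁅a, b⁆ = ⁅a', b'⁆ := by
  have central {z : E} (hz : z ∈ π.ker) (x : E) : ⁅x, z⁆ = 1 :=
    commutatorElement_eq_one_iff_mul_comm.2 (Subgroup.mem_center_iff.1 (hc hz) x)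
  have central' {z : E} (hz : z ∈ π.ker) (x : E) : ⁅z, x⁆ = 1 := by
    rw [← commutatorElement_inv, central hz, inv_one]
  have ha' : a'⁻¹ * a ∈ π.ker := by simp [MonoidHom.mem_ker, ha]
  have hb' : b'⁻¹ * b ∈ π.ker := by simp [MonoidHom.mem_ker, hb]
  rw [← mul_inv_cancel_left a' a, commutatorElement_mul_left_of_ker_le_center hc, central' ha',
    mul_one, ← mul_inv_cancel_left b' b, commutatorElement_mul_right_of_ker_le_center hc,
    central hb', mul_one]

/-- The alternating bihomomorphism on `G` obtained by applying a character of the kernel of a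
central extension of `G` to commutators of lifts. -/
noncomputable def commutatorPairing (hs : Function.Surjective π)
    (hc : π.ker ≤ Subgroup.center E) (χ : π.ker →* M) : AlternatingBihom G M :=
  ⟨MonoidHom.mk' (fun g => MonoidHom.mk'
      (fun h => χ ⟨⁅Function.surjInv hs g, Function.surjInv hs h⁆, commutatorElement_mem_ker π _ _⟩)
      fun h h' => by
        rw [← map_mul]
        congr 1
        ext
        simp only [Subgroup.coe_mul]
        rw [← commutatorElement_mul_right_of_ker_le_center hc]
        exact commutatorElement_congr_of_ker_le_center hc rfl
          (by simp [Function.surjInv_eq hs]))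
    fun g g' => by
      ext h : 1
      simp only [MonoidHom.mk'_apply, MonoidHom.mul_apply]
      rw [← map_mul]
      congr 1
      ext
      simp only [Subgroup.coe_mul]
      rw [← commutatorElement_mul_left_of_ker_le_center hc]
      exact commutatorElement_congr_of_ker_le_center hc (by simp [Function.surjInv_eq hs]) rfl,
    fun g => by
      rw [MonoidHom.mk'_apply, MonoidHom.mk'_apply, ← map_one χ]
      congr 1
      ext
      simp⟩

theorem commutatorPairing_apply (hs : Function.Surjective π) (hc : π.ker ≤ Subgroup.center E)
    (χ : π.ker →* M) (a b : E) :
    (commutatorPairing hs hc χ).1 (π a) (π b) = χ ⟨⁅a, b⁆, commutatorElement_mem_ker π a b⟩ := by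
  simp only [commutatorPairing, MonoidHom.mk'_apply]
  congr 2
  exact commutatorElement_congr_of_ker_le_center hc (Function.surjInv_eq hs _)
    (Function.surjInv_eq hs _)

/-- If the kernel is generated by commutators, a character of it is determined by its pairing. -/
theorem commutatorPairing_injective (hs : Function.Surjective π)
    (hc : π.ker ≤ Subgroup.center E) (hk : π.ker ≤ commutator E) :
    Function.Injective (commutatorPairing (M := M) hs hc) := by
  intro χ χ' h
  have hle : commutator E ≤ (χ.eqLocus χ').map π.ker.subtype := by
    rw [commutator_def, Subgroup.commutator_le]
    intro a _ b _
    refine ⟨⟨⁅a, b⁆, commutatorElement_mem_ker π a b⟩, ?_, rfl⟩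
    change χ _ = χ' _
    rw [← commutatorPairing_apply hs hc, ← commutatorPairing_apply hs hc, h]
  ext1 x
  obtain ⟨y, hy, hyx⟩ := hle (hk x.2)
  obtain rfl : y = x := Subtype.ext hyx
  exact hy

/-- A central extension of a finite commutative group has finite commutator subgroup. -/
theorem finite_commutator_of_ker_le_center [Finite G] (hs : Function.Surjective π)
    (hc : π.ker ≤ Subgroup.center E) : Finite (commutator E) := by
  have : Finite (commutatorSet E) := by
    refine Set.Finite.subset (Set.finite_range fun p : G × G =>
      ⁅Function.surjInv hs p.1, Function.surjInv hs p.2⁆) ?_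
    rintro _ ⟨a, b, rfl⟩
    exact ⟨(π a, π b), commutatorElement_congr_of_ker_le_center hc (Function.surjInv_eq hs _)
      (Function.surjInv_eq hs _)⟩
  -- Finitely many commutators generate a finite commutator subgroup.
  infer_instance

end CommutatorPairing

/-- The image of the centre of a cover of a finite commutative group `G` is the common radical of
all alternating bihomomorphisms from `G` to `ℂˣ`. -/
theorem IsCover.mem_map_center_iff {G : Type u} [CommGroup G] [Finite G] {E : Type*} [Group E]
    {π : E →* G} (hπ : IsCover π) (g : G) :
    g ∈ (Subgroup.center E).map π ↔ ∀ ω : AlternatingBihom G ℂˣ, ∀ h, ω.1 g h = 1 := by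
  have hs := hπ.surjective
  have hc := hπ.ker_le_center
  have := finite_commutator_of_ker_le_center hs hc
  have : Finite π.ker := Finite.of_injective _ (Subgroup.inclusion_injective hπ.ker_le_commutator)
  let _ : CommGroup π.ker :=
    { (inferInstance : Group π.ker) with
      mul_comm := fun a b => Subtype.ext (Subgroup.mem_center_iff.1 (hc b.2) a) }
  obtain ⟨e⟩ := hπ.ker_equiv
  have : Finite (SchurMultiplier G) := Finite.of_equiv _ e.toEquiv
  obtain ⟨f, hf⟩ := SchurMultiplier.exists_injective_alternatingBihom G
  have : Finite (AlternatingBihom G ℂˣ) := Finite.of_injective f hf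
  -- A finite commutative group has as many complex characters as elements.
  have hcard : Nat.card (AlternatingBihom G ℂˣ) ≤ Nat.card (π.ker →* ℂˣ) := by
    rw [CommGroup.card_monoidHom_of_hasEnoughRootsOfUnity]
    exact (Nat.card_le_card_of_injective f hf).trans (Nat.card_congr e.toEquiv).ge
  have hsurj := ((commutatorPairing_injective (M := ℂˣ) hs hc
    hπ.ker_le_commutator).bijective_of_nat_card_le hcard).surjective
  constructor
  · rintro ⟨a, ha, rfl⟩ ω h
    obtain ⟨χ, rfl⟩ := hsurj ω
    obtain ⟨b, rfl⟩ := hs h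
    rw [commutatorPairing_apply, ← map_one χ]
    congr 1
    exact Subtype.ext (commutatorElement_eq_one_iff_mul_comm.2
      (Subgroup.mem_center_iff.1 ha b).symm)
  · intro h
    obtain ⟨a, rfl⟩ := hs g
    refine ⟨a, Subgroup.mem_center_iff.2 fun b => ?_, rfl⟩
    refine (commutatorElement_eq_one_iff_mul_comm.1 ?_).symm
    have h1 : (⟨⁅a, b⁆, commutatorElement_mem_ker π a b⟩ : π.ker) = 1 := by
      -- Characters separate the points of the finite kernel.
      refine (CommGroup.forall_apply_eq_apply_iff π.ker (M := ℂ)).1 fun χ => ?_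
      rw [← commutatorPairing_apply hs hc, h, map_one]
    exact congrArg Subtype.val h1

theorem corollary4p8 {G : Type*} [CommGroup G] [Finite G]
    {E₁ : Type*} [Group E₁] (π₁ : E₁ →* G) (h₁ : IsCover π₁)
    {E₂ : Type*} [Group E₂] (π₂ : E₂ →* G) (h₂ : IsCover π₂) :
    (Subgroup.center E₁).map π₁ = (Subgroup.center E₂).map π₂ := by
  ext g
  rw [h₁.mem_map_center_iff, h₂.mem_map_center_iff]
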